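/- Let $(Y^1,\dots,Y^n)$ be the potential outcomes under the treatments $d^1,\dots,d^n$, $D\in\{d^1,\dots,d^n\}$ the treatment taken, $\mathbf Z$ the covariates, and $Y$ the observed outcome, i.e. $Y=Y^j$ when $D=d^j$. Fix $i$ and suppose $$Y^i=g^i(\mathbf Z)+\xi^i,\quad \mathbb E[\xi^i\mid\mathbf Z]=0,\qquad \mathbf 1_{\{D=d^i\}}=\pi^i(\mathbf Z)+\nu^i,\quad \mathbb E[\nu^i\mid\mathbf Z]=0,$$ with $g^i(\mathbf Z)$ and $\xi^i$ integrable and $\xi^i$ independent of $\nu^i$. Let $\theta^i=\mathbb E[g^i(\mathbf Z)]$, let $2\le k\le r$ be integers with $\mathbb E[(\nu^i)^r]\ne0$, and put $\bar b_r=1/\mathbb E[(\nu^i)^r]$ and, for $q=k-1,k-2,\dots,1$, $$b_q=-\sum_{u=1}^{k-1-q}b_{q+u}\binom{q+u}{q}\mathbb E[(\nu^i)^u]-\bar b_r\binom rq\mathbb E[(\nu^i)^{r-q}].$$ For real functions $f,a$ of the covariates let $$A(D,\mathbf Z;a)=\bar b_r[\mathbf 1_{\{D=d^i\}}-a(\mathbf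 Z)]^r+\sum_{q=1}^{k-1}b_q\big([\mathbf 1_{\{D=d^i\}}-a(\mathbf Z)]^q-\mathbb E[(\nu^i)^q]\big),$$ $$\psi^i(\vartheta,f,a)=\vartheta-f(\mathbf Z)-(Y^i-f(\mathbf Z))A(D,\mathbf Z;a).$$ Given i.i.d. individuals, consider data sets, each split into disjoint sets $\mathcal I$ and $\mathcal I^c$ of individuals, with $N=|\mathcal I|\to\infty$, and let $\hat g^i,\hat\pi^i$ be measurable functions of the observations $(Y_m,D_m,\mathbf Z_m)$, $m\in\mathcal I^c$, and of the covariate argument. Write $\psi^i_m$ for the score of individual $m$. (1) If $\mathcal I\neq\emptyset$, the equation $\frac1N\sum_{m\in\mathcal I}\psi^i_m(\vartheta,\hat g^i,\hat\pi^i)=0$ has the unique solution $$\vartheta=\tilde\theta^i_N=\frac1N\sum_{m\in\mathcal I}\hat g^i(\mathbf Z_m)+\frac1N\sum_{m\in\mathcal I}(Y^i_m-\hat g^i(\mathbf Z_m))A(D_m,\mathbf Z_m;\hat\pi^i).$$ (2) Suppose that, for $\mathbf Z$ a fresh draw independent of the data, $\mathbb E[(\hat g^i(\mathbf Z)-g^i(\mathbf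 Z))^2\mid\mathcal I^c]\to0$ and $\mathbb E[(\hat\pi^i(\mathbf Z)-\pi^i(\mathbf Z))^2\mid\mathcal I^c]\to0$ in probability, and that there is a set $\mathcal T$ of pairs of functions such that $\mathbb P\{(\hat g^i,\hat\pi^i)\in\mathcal T\}\to1$ and $\sup_{(f,a)\in\mathcal T}\mathbb E[\psi^i(\theta^i,f,a)^2]<\infty$. Then $\tilde\theta^i_N$ is a consistent estimator of $\theta^i$: $\mathbb P\{|\tilde\theta^i_N-\theta^i|\ge\epsilon\}\to0$ for every $\epsilon>0$. -/

import Mathlib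

open MeasureTheory ProbabilityTheory Filter Topology
open scoped ENNReal NNReal

noncomputable section

namespace HOEst

/-- The full record of one individual: the potential outcomes `(Y¹, …, Yⁿ)`, the index of the
treatment `D` actually taken (`j` stands for the treatment `dʲ`), and the covariates `Z`. -/
abbrev Record (n : ℕ) (𝒵 : Type*) := (Fin n → ℝ) × Fin n × 𝒵

/-- The observable record `W = (Y, D, Z)` of one individual. -/
abbrev Observed (n : ℕ) (𝒵 : Type*) := ℝ × Fin n × 𝒵

variable {n : ℕ} {𝒵 : Type*}

/-- The potential outcome `Yⁱ` under treatment `i`. -/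
def outcome (i : Fin n) (w : Record n 𝒵) : ℝ := w.1 i

/-- The treatment taken. -/
def treat (w : Record n 𝒵) : Fin n := w.2.1

/-- The covariates. -/
def covar (w : Record n 𝒵) : 𝒵 := w.2.2

/-- The observed part of a record: the response is the outcome under the treatment taken. -/
def observe (w : Record n 𝒵) : Observed n 𝒵 := (outcome (treat w) w, treat w, covar w)

/-- The indicator `1_{D = dⁱ}`. -/
def treatInd (i : Fin n) (w : Record n 𝒵) : ℝ := if treat w = i then 1 else 0

/-- The residual `1_{D = dⁱ} - a(Z)`; it is the noise `νⁱ` when `a` is the propensity score. -/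
def treatNoise (i : Fin n) (a : 𝒵 → ℝ) (w : Record n 𝒵) : ℝ := treatInd i w - a (covar w)

/-- The residual `Yⁱ - g(Z)`; it is the noise `ξⁱ` when `g` is the true outcome function `gⁱ`. -/
def outcomeNoise (i : Fin n) (g : 𝒵 → ℝ) (w : Record n 𝒵) : ℝ := outcome i w - g (covar w)

section Score

/-- `b̄_r = 1 / e_r`, where `e_q` stands for `E[(νⁱ)^q]`. -/
def coeffTop (e : ℕ → ℝ) (r : ℕ) : ℝ := 1 / e r

/-- The coefficients `b_q`, `1 ≤ q ≤ k - 1`, by descending recursion: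
`b_q = - ∑_{u=1}^{k-1-q} b_{q+u} C(q+u, q) e_u - b̄_r C(r, q) e_{r-q}`. -/
def coeff (e : ℕ → ℝ) (r k : ℕ) (q : ℕ) : ℝ :=
  -(∑ u ∈ (Finset.Icc 1 (k - 1 - q)).attach,
      coeff e r k (q + u.1) * ((q + u.1).choose q : ℝ) * e u.1)
    - coeffTop e r * (r.choose q : ℝ) * e (r - q)
termination_by k - q
decreasing_by
  have h := Finset.mem_Icc.mp u.2
  omega

/-- `A(D, Z; a) = b̄_r [1_{D=dⁱ} - a(Z)]^r + ∑_{q=1}^{k-1} b_q ([1_{D=dⁱ} - a(Z)]^q - e_q)`. -/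
def weight (e : ℕ → ℝ) (r k : ℕ) (i : Fin n) (a : 𝒵 → ℝ) (w : Record n 𝒵) : ℝ :=
  coeffTop e r * treatNoise i a w ^ r
    + ∑ q ∈ Finset.Icc 1 (k - 1), coeff e r k q * (treatNoise i a w ^ q - e q)

/-- The score `ψⁱ(W, ϑ, (f, a)) = ϑ - f(Z) - (Yⁱ - f(Z)) A(D, Z; a)`. -/
def score (e : ℕ → ℝ) (r k : ℕ) (i : Fin n) (w : Record n 𝒵) (ϑ : ℝ) (f a : 𝒵 → ℝ) : ℝ :=
  ϑ - f (covar w) - (outcome i w - f (covar w)) * weight e r k i a w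

/-- The estimator
`(1/N) ∑_{m ∈ I} f(Z_m) + (1/N) ∑_{m ∈ I} (Yⁱ_m - f(Z_m)) A(D_m, Z_m; a)`, `N = |I|`. -/
def estimator (e : ℕ → ℝ) (r k : ℕ) (i : Fin n) (I : Finset ℕ) (v : ℕ → Record n 𝒵)
    (f a : 𝒵 → ℝ) : ℝ :=
  (1 / (I.card : ℝ)) * ∑ m ∈ I, f (covar (v m))
    + (1 / (I.card : ℝ)) *
        ∑ m ∈ I, (outcome i (v m) - f (covar (v m))) * weight e r k i a (v m)

end Score

variable [MeasurableSpace 𝒵]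

/-- The moment `E[(νⁱ)^q]` under the population law `P`. -/
def noiseMoment (P : Measure (Record n 𝒵)) (i : Fin n) (π : 𝒵 → ℝ) (q : ℕ) : ℝ :=
  ∫ w, treatNoise i π w ^ q ∂P

/-- The population model for treatment `i`: `Yⁱ = g(Z) + ξ` with `E[ξ | Z] = 0`,
`1_{D = dⁱ} = π(Z) + ν` with `E[ν | Z] = 0`, and `ξ` independent of `ν`. -/
structure Model (P : Measure (Record n 𝒵)) (i : Fin n) (g π : 𝒵 → ℝ) : Prop where
  measurable_g : Measurable g
  measurable_π : Measurable π
  integrable_g : Integrable (fun w => g (covar w)) P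
  integrable_ξ : Integrable (outcomeNoise i g) P
  /-- `π(Z) = E[1_{D = dⁱ} | Z]`: `π` is the propensity score. -/
  propensity : P[treatInd i | MeasurableSpace.comap covar inferInstance]
    =ᵐ[P] fun w => π (covar w)
  condExp_ξ : P[outcomeNoise i g | MeasurableSpace.comap covar inferInstance] =ᵐ[P] 0
  indep : IndepFun (outcomeNoise i g) (treatNoise i π) P

/-- A learner which turns the observed records of the individuals in `J` into a real function of
the covariates, jointly measurable in the data and the covariates. -/
structure Learner (n : ℕ) (𝒵 : Type*) [MeasurableSpace 𝒵] (J : Finset ℕ) where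
  toFun : (J → Observed n 𝒵) → 𝒵 → ℝ
  measurable_toFun : Measurable fun p : (J → Observed n 𝒵) × 𝒵 => toFun p.1 p.2

/-- The function trained on the observed records of the individuals in `J`. -/
def Learner.train {J : Finset ℕ} (L : Learner n 𝒵 J) (v : ℕ → Record n 𝒵) : 𝒵 → ℝ :=
  L.toFun fun j => observe (v j)

/-- The mean squared distance `E[(f(Z) - h(Z))²]`, with `Z` a fresh draw from the population. -/
def mse (P : Measure (Record n 𝒵)) (f h : 𝒵 → ℝ) : ℝ≥0∞ :=
  ∫⁻ w, ‖f (covar w) - h (covar w)‖ₑ ^ 2 ∂P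

/-- Convergence to zero in probability of `[0, ∞]`-valued random quantities. -/
def ToZeroInProb {Ω : Type*} [MeasurableSpace Ω] (μ : Measure Ω) (X : ℕ → Ω → ℝ≥0∞) : Prop :=
  ∀ ε : ℝ≥0∞, 0 < ε → Tendsto (fun t => μ {ω | ε ≤ X t ω}) atTop (𝓝 0)

/-- The conditions on the nuisance estimates: both are mean-square consistent, and with probability
tending to one they lie in a set `𝒯` of nuisance values over which the score, at the true
causal parameter `θ`, has bounded second moment. -/
structure NuisanceConditions {Ω : Type*} [MeasurableSpace Ω] (μ : Measure Ω)
    (P : Measure (Record n 𝒵)) (r k : ℕ) (i : Fin n) (g π : 𝒵 → ℝ) (θ : ℝ)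
    (ghat pihat : ℕ → Ω → 𝒵 → ℝ) (𝒯 : Set ((𝒵 → ℝ) × (𝒵 → ℝ))) : Prop where
  consistent_g : ToZeroInProb μ fun t ω => mse P (ghat t ω) g
  consistent_π : ToZeroInProb μ fun t ω => mse P (pihat t ω) π
  eventually_mem : Tendsto (fun t => μ {ω | (ghat t ω, pihat t ω) ∉ 𝒯}) atTop (𝓝 0)
  regular : ∃ M : ℝ≥0, ∀ h ∈ 𝒯,
    ∫⁻ w, ‖score (noiseMoment P i π) r k i w θ h.1 h.2‖ₑ ^ 2 ∂P ≤ (M : ℝ≥0∞)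

end HOEst

end

open HOEst

/-! At the true nuisance functions the residual `outcomeNoise i g` is independent of the weight, a
polynomial in `treatNoise i π`, and has mean zero. Hence the score at θ has mean zero, whatever the
coefficients of that polynomial (`Model.integral_score`).

This mean is continuous at the truth along nuisance pairs with a common second moment bound M for
the score: mean-square convergence yields almost sure convergence along fast sequences, and the
bound supplies the uniform integrability for Vitali's theorem
(`Model.exists_abs_integral_score_le`). No rate is needed.

The average score at θ is θ minus the estimator. Training and estimation samples are independent, so
the trained functions can be frozen by Fubini. On the good event, where they are close to the truth
and satisfy the bound M, the frozen mean is at most ε / 2 and Chebyshev bounds the error probability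
by 4M / (ε²N) (`measure_estimator_error_le`). The complement of the good event is asymptotically
negligible by assumption. -/

namespace HOEst

/-! ### Uniform integrability, Chebyshev and Fubini -/

section Integration

variable {α : Type*} [MeasurableSpace α] {μ : Measure α}

lemma eLpNorm_two_le_of_lintegral_sq_le {f : α → ℝ} {M : ℝ≥0}
    (hM : ∫⁻ x, ‖f x‖ₑ ^ 2 ∂μ ≤ M) : eLpNorm f 2 μ ≤ (M : ℝ≥0∞) ^ (1 / 2 : ℝ) := by
  rw [eLpNorm_eq_lintegral_rpow_enorm_toReal (by simp) (by simp)]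
  simp only [ENNReal.toReal_ofNat, ENNReal.rpow_ofNat]
  exact ENNReal.rpow_le_rpow hM (by norm_num)

lemma memLp_two_of_lintegral_sq_le {f : α → ℝ} (hf : AEStronglyMeasurable f μ) {M : ℝ≥0}
    (hM : ∫⁻ x, ‖f x‖ₑ ^ 2 ∂μ ≤ M) : MemLp f 2 μ :=
  ⟨hf, (eLpNorm_two_le_of_lintegral_sq_le hM).trans_lt
    (ENNReal.rpow_lt_top_of_nonneg (by norm_num) ENNReal.coe_ne_top)⟩

lemma integral_sq_le_of_lintegral_sq_le {f : α → ℝ} {M : ℝ≥0}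
    (hM : ∫⁻ x, ‖f x‖ₑ ^ 2 ∂μ ≤ M) : ∫ x, f x ^ 2 ∂μ ≤ M := by
  by_cases hf : AEStronglyMeasurable (fun x => f x ^ 2) μ
  · rw [integral_eq_lintegral_of_nonneg_ae (ae_of_all _ fun x => sq_nonneg _) hf]
    refine ENNReal.toReal_le_of_le_ofReal M.2 ?_
    refine le_trans (le_of_eq (lintegral_congr fun x => ?_)) (hM.trans (by simp))
    rw [← Real.enorm_of_nonneg (sq_nonneg (f x)), enorm_pow]
  · rw [integral_undef fun h => hf h.1]
    exact M.2

/-- Cauchy–Schwarz: the L¹ norm of `f j` on `s` is at most √M · √(μ s), uniformly in `j`. -/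
lemma unifIntegrable_one_of_lintegral_sq_le {ι : Type*} {f : ι → α → ℝ}
    (hf : ∀ j, AEStronglyMeasurable (f j) μ) {M : ℝ≥0}
    (hM : ∀ j, ∫⁻ x, ‖f j x‖ₑ ^ 2 ∂μ ≤ M) : UnifIntegrable f 1 μ := by
  intro ε hε
  have hC : 0 < (M : ℝ) + 1 := by positivity
  -- Chosen so that √(M · ε² / (M + 1)) ≤ ε; the `+ 1` covers M = 0.
  refine ⟨ε ^ 2 / (M + 1), by positivity, fun j s hs hsμ => ?_⟩
  rw [eLpNorm_indicator_eq_eLpNorm_restrict hs]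
  have h1 := eLpNorm_le_eLpNorm_mul_rpow_measure_univ (μ := μ.restrict s) (f := f j)
    (p := 1) (q := 2) (by norm_num) (hf j).restrict
  refine h1.trans ?_
  have h2 : eLpNorm (f j) 2 (μ.restrict s) ≤ (M : ℝ≥0∞) ^ (1 / 2 : ℝ) :=
    (eLpNorm_mono_measure _ Measure.restrict_le_self).trans
      (eLpNorm_two_le_of_lintegral_sq_le (hM j))
  have h3 : (1 / (1 : ℝ≥0∞).toReal - 1 / (2 : ℝ≥0∞).toReal) = (1 / 2 : ℝ) := by norm_num
  rw [h3, Measure.restrict_apply_univ]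
  calc eLpNorm (f j) 2 (μ.restrict s) * μ s ^ (1 / 2 : ℝ)
      ≤ (M : ℝ≥0∞) ^ (1 / 2 : ℝ) * (ENNReal.ofReal (ε ^ 2 / (M + 1))) ^ (1 / 2 : ℝ) := by
        gcongr
    _ = ENNReal.ofReal ((M * (ε ^ 2 / (M + 1))) ^ (1 / 2 : ℝ)) := by
        rw [← ENNReal.mul_rpow_of_nonneg _ _ (by norm_num), ← ENNReal.ofReal_coe_nnreal,
          ← ENNReal.ofReal_mul M.coe_nonneg, ENNReal.ofReal_rpow_of_nonneg (by positivity) (by norm_num)]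
    _ ≤ ENNReal.ofReal ε := by
        apply ENNReal.ofReal_le_ofReal
        rw [← Real.sqrt_eq_rpow]
        apply Real.sqrt_le_iff.2 ⟨hε.le, ?_⟩
        rw [mul_div_assoc', div_le_iff₀ hC]
        nlinarith [sq_nonneg ε]

/-- Vitali convergence of means under a uniform second moment bound. -/
lemma tendsto_integral_of_lintegral_sq_le [IsFiniteMeasure μ] {f : ℕ → α → ℝ} {h : α → ℝ}
    (hf : ∀ j, AEStronglyMeasurable (f j) μ) {M : ℝ≥0}
    (hM : ∀ j, ∫⁻ x, ‖f j x‖ₑ ^ 2 ∂μ ≤ M) (hh : Integrable h μ)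
    (hlim : ∀ᵐ x ∂μ, Tendsto (fun j => f j x) atTop (𝓝 (h x))) :
    Tendsto (fun j => ∫ x, f j x ∂μ) atTop (𝓝 (∫ x, h x ∂μ)) := by
  refine tendsto_integral_of_L1' h hh.1
    (Eventually.of_forall fun j =>
      (memLp_two_of_lintegral_sq_le (hf j) (hM j)).integrable (by norm_num)) ?_
  exact tendsto_Lp_finite_of_tendsto_ae le_rfl (by simp) hf (memLp_one_iff_integrable.2 hh)
    (unifIntegrable_one_of_lintegral_sq_le hf hM) hlim

/-- Summably fast mean-square convergence implies almost sure convergence. -/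
lemma ae_tendsto_of_tsum_lintegral_sq_ne_top {f : ℕ → α → ℝ} {h : α → ℝ}
    (hf : ∀ j, Measurable (f j)) (hh : Measurable h)
    (hsum : ∑' j, ∫⁻ x, ‖f j x - h x‖ₑ ^ 2 ∂μ ≠ ∞) :
    ∀ᵐ x ∂μ, Tendsto (fun j => f j x) atTop (𝓝 (h x)) := by
  have hmeas : ∀ j, Measurable fun x => ‖f j x - h x‖ₑ ^ 2 := fun j =>
    ((hf j).sub hh).enorm.pow_const 2
  -- By Tonelli the series of squared errors has finite integral, so it converges almost everywhere
  -- and its terms tend to zero.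
  rw [← lintegral_tsum fun j => (hmeas j).aemeasurable] at hsum
  filter_upwards [ae_lt_top (Measurable.tsum hmeas) hsum] with x hx
  have h1 := ENNReal.tendsto_atTop_zero_of_tsum_ne_top hx.ne
  have h2 := ((ENNReal.continuous_rpow_const (y := (1 / 2 : ℝ))).tendsto 0).comp h1
  rw [tendsto_iff_edist_tendsto_0]
  refine (h2.congr fun j => ?_).trans (by simp)
  simp only [Function.comp_apply, edist_eq_enorm_sub]
  rw [← ENNReal.rpow_natCast, ← ENNReal.rpow_mul]
  norm_num

/-- Chebyshev's inequality for the average of pairwise independent variables with small means and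
bounded second moments. -/
lemma measure_le_abs_average_le [IsProbabilityMeasure μ] {Y : ℕ → α → ℝ} {s : Finset ℕ}
    (hs : s.Nonempty) (hY : ∀ m ∈ s, Measurable (Y m))
    (hind : Set.Pairwise (s : Set ℕ) fun m l => IndepFun (Y m) (Y l) μ) {M : ℝ≥0}
    (hM : ∀ m ∈ s, ∫⁻ x, ‖Y m x‖ₑ ^ 2 ∂μ ≤ M) {ε : ℝ} (hε : 0 < ε)
    (hmean : ∀ m ∈ s, |∫ x, Y m x ∂μ| ≤ ε / 2) :
    μ {x | ε ≤ |(1 / (s.card : ℝ)) * ∑ m ∈ s, Y m x|}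
      ≤ ENNReal.ofReal (4 * M / ε ^ 2 * (1 / (s.card : ℝ))) := by
  have hN : 0 < (s.card : ℝ) := by exact_mod_cast hs.card_pos
  have hL : ∀ m ∈ s, MemLp (Y m) 2 μ := fun m hm =>
    memLp_two_of_lintegral_sq_le (hY m hm).aestronglyMeasurable (hM m hm)
  have hLS : MemLp (∑ m ∈ s, Y m) 2 μ := memLp_finsetSum' s hL
  have hvar : variance (∑ m ∈ s, Y m) μ ≤ s.card * M := by
    rw [IndepFun.variance_sum hL hind, ← nsmul_eq_mul]
    refine Finset.sum_le_card_nsmul _ _ _ fun m hm => ?_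
    exact (variance_le_expectation_sq (hY m hm).aestronglyMeasurable).trans
      (integral_sq_le_of_lintegral_sq_le (hM m hm))
  have hES : |∫ x, (∑ m ∈ s, Y m) x ∂μ| ≤ s.card * (ε / 2) := by
    simp only [Finset.sum_apply]
    rw [integral_finsetSum s fun m hm => (hL m hm).integrable (by norm_num), ← nsmul_eq_mul]
    exact (Finset.abs_sum_le_sum_abs _ _).trans (Finset.sum_le_card_nsmul _ _ _ hmean)
  have hc : 0 < s.card * (ε / 2) := by positivity
  calc μ {x | ε ≤ |(1 / (s.card : ℝ)) * ∑ m ∈ s, Y m x|}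
      ≤ μ {x | s.card * (ε / 2) ≤
          |(∑ m ∈ s, Y m) x - ∫ y, (∑ m ∈ s, Y m) y ∂μ|} := by
        -- The sum exceeds Nε in absolute value while its mean is at most Nε / 2, so it deviates
        -- from its mean by at least Nε / 2.
        refine measure_mono fun x hx => ?_
        simp only [Set.mem_ofPred_eq] at hx ⊢
        rw [abs_mul, abs_of_pos (one_div_pos.2 hN), one_div, inv_mul_eq_div, le_div_iff₀ hN,
          ← Finset.sum_apply] at hx
        have := abs_sub_abs_le_abs_sub ((∑ m ∈ s, Y m) x) (∫ y, (∑ m ∈ s, Y m) y ∂μ)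
        linarith
    _ ≤ ENNReal.ofReal (variance (∑ m ∈ s, Y m) μ / (s.card * (ε / 2)) ^ 2) :=
        meas_ge_le_variance_div_sq hLS hc
    _ ≤ ENNReal.ofReal (4 * M / ε ^ 2 * (1 / (s.card : ℝ))) := by
        apply ENNReal.ofReal_le_ofReal
        rw [div_le_iff₀ (by positivity)]
        refine hvar.trans (le_of_eq ?_)
        field_simp
        norm_num

/-- If `X` and `U` are independent, then an event about `(X, U)` has probability at most `c` once
all its sections at values `x` of `X` have probability at most `c`. -/
lemma measure_le_of_indepFun_of_forall_section_le [IsProbabilityMeasure μ] {β γ : Type*}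
    [MeasurableSpace β] [MeasurableSpace γ] {X : α → β} {U : α → γ} (hX : Measurable X)
    (hU : Measurable U) (hXU : IndepFun X U μ) {S : Set (β × γ)} (hS : MeasurableSet S)
    {c : ℝ≥0∞} (hc : ∀ x, μ {ω | (x, U ω) ∈ S} ≤ c) : μ {ω | (X ω, U ω) ∈ S} ≤ c := by
  have := Measure.isProbabilityMeasure_map (μ := μ) hX.aemeasurable
  change μ ((fun ω => (X ω, U ω)) ⁻¹' S) ≤ c
  rw [← Measure.map_apply (hX.prodMk hU) hS,
    hXU.map_prod_eq_prod_map_map hX.aemeasurable hU.aemeasurable, Measure.prod_apply hS]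
  calc ∫⁻ x, μ.map U (Prod.mk x ⁻¹' S) ∂μ.map X ≤ ∫⁻ _, c ∂μ.map X := by
        refine lintegral_mono fun x => ?_
        rw [Measure.map_apply hU (measurable_prodMk_left hS)]
        exact hc x
    _ = c := by simp

end Integration

/-! ### The score as an affine function of ϑ and a polynomial in the nuisance values -/

section Algebra

variable {n : ℕ} {𝒵 : Type*}

lemma average_score_eq (e : ℕ → ℝ) (r k : ℕ) (i : Fin n) {I : Finset ℕ} (hI : I.Nonempty)
    (v : ℕ → Record n 𝒵) (f a : 𝒵 → ℝ) (ϑ : ℝ) :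
    (1 / (I.card : ℝ)) * ∑ m ∈ I, score e r k i (v m) ϑ f a
      = ϑ - estimator e r k i I v f a := by
  have hN : (I.card : ℝ) ≠ 0 := by exact_mod_cast hI.card_pos.ne'
  simp only [score, estimator, Finset.sum_sub_distrib, Finset.sum_const, nsmul_eq_mul]
  field_simp
  ring

lemma tendsto_score (e : ℕ → ℝ) (r k : ℕ) (i : Fin n) (w : Record n 𝒵) (ϑ : ℝ)
    {f a : ℕ → 𝒵 → ℝ} {g π : 𝒵 → ℝ}
    (hf : Tendsto (fun j => f j (covar w)) atTop (𝓝 (g (covar w))))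
    (ha : Tendsto (fun j => a j (covar w)) atTop (𝓝 (π (covar w)))) :
    Tendsto (fun j => score e r k i w ϑ (f j) (a j)) atTop (𝓝 (score e r k i w ϑ g π)) := by
  simp only [score, weight, treatNoise]
  refine (tendsto_const_nhds.sub hf).sub ((tendsto_const_nhds.sub hf).mul ?_)
  refine (((tendsto_const_nhds.sub ha).pow r).const_mul _).add (tendsto_finsetSum _ fun q _ => ?_)
  exact (((tendsto_const_nhds.sub ha).pow q).sub_const _).const_mul _

lemma score_true_eq (e : ℕ → ℝ) (r k : ℕ) (i : Fin n) (g π : 𝒵 → ℝ) (θ : ℝ) (w : Record n 𝒵) :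
    score e r k i w θ g π
      = θ - g (covar w) - (outcomeNoise i g * weight e r k i π) w := rfl

end Algebra

/-! ### Joint measurability in data and covariates -/

section Measurability

variable {n : ℕ} {𝒵 : Type*} [MeasurableSpace 𝒵]

lemma measurable_outcome (i : Fin n) : Measurable (outcome (𝒵 := 𝒵) i) :=
  (measurable_pi_apply i).comp measurable_fst

lemma measurable_treat : Measurable (treat (n := n) (𝒵 := 𝒵)) :=
  measurable_fst.comp measurable_snd

lemma measurable_covar : Measurable (covar (n := n) (𝒵 := 𝒵)) :=
  measurable_snd.comp measurable_snd

lemma measurable_treatInd (i : Fin n) : Measurable (treatInd (𝒵 := 𝒵) i) :=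
  (measurable_of_finite fun j : Fin n => if j = i then (1 : ℝ) else 0).comp measurable_treat

lemma measurable_observe : Measurable (observe (n := n) (𝒵 := 𝒵)) := by
  refine Measurable.prodMk ?_ measurable_snd
  have h : Measurable fun p : Fin n × (Fin n → ℝ) => p.2 p.1 :=
    measurable_from_prod_countable_right fun j => measurable_pi_apply j
  exact h.comp (measurable_treat.prodMk measurable_fst)

lemma measurable_score {β : Type*} [MeasurableSpace β] (e : ℕ → ℝ) (r k : ℕ) (i : Fin n) (ϑ : ℝ)
    {f a : β → 𝒵 → ℝ} (hf : Measurable fun p : β × 𝒵 => f p.1 p.2)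
    (ha : Measurable fun p : β × 𝒵 => a p.1 p.2) :
    Measurable fun p : β × Record n 𝒵 => score e r k i p.2 ϑ (f p.1) (a p.1) := by
  have hz : Measurable fun p : β × Record n 𝒵 => (p.1, covar p.2) :=
    measurable_fst.prodMk (measurable_covar.comp measurable_snd)
  have hf' : Measurable fun p : β × Record n 𝒵 => f p.1 (covar p.2) := hf.comp hz
  have ha' : Measurable fun p : β × Record n 𝒵 => a p.1 (covar p.2) := ha.comp hz
  have hy : Measurable fun p : β × Record n 𝒵 => outcome i p.2 :=
    (measurable_outcome i).comp measurable_snd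
  have hd : Measurable fun p : β × Record n 𝒵 => treatInd i p.2 :=
    (measurable_treatInd i).comp measurable_snd
  simp only [score, weight, treatNoise]
  fun_prop

lemma measurable_score_right (e : ℕ → ℝ) (r k : ℕ) (i : Fin n) (ϑ : ℝ) {f a : 𝒵 → ℝ}
    (hf : Measurable f) (ha : Measurable a) :
    Measurable fun w : Record n 𝒵 => score e r k i w ϑ f a :=
  (measurable_score (β := Unit) e r k i ϑ (f := fun _ => f) (a := fun _ => a)
    (hf.comp measurable_snd) (ha.comp measurable_snd)).comp
    (measurable_const (a := ()).prodMk measurable_id)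

lemma measurable_mse {β : Type*} [MeasurableSpace β] (P : Measure (Record n 𝒵)) [SFinite P]
    {f : β → 𝒵 → ℝ} {g : 𝒵 → ℝ} (hf : Measurable fun p : β × 𝒵 => f p.1 p.2)
    (hg : Measurable g) : Measurable fun x => mse P (f x) g := by
  have hz : Measurable fun p : β × Record n 𝒵 => (p.1, covar p.2) :=
    measurable_fst.prodMk (measurable_covar.comp measurable_snd)
  exact Measurable.lintegral_prod_right' (f := fun p : β × Record n 𝒵 =>
      ‖f p.1 (covar p.2) - g (covar p.2)‖ₑ ^ 2)
    (((hf.comp hz).sub (hg.comp (measurable_covar.comp measurable_snd))).enorm.pow_const 2)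

end Measurability

/-! ### Mean of the score under the population law -/

section Population

variable {n : ℕ} {𝒵 : Type*} [MeasurableSpace 𝒵] {P : Measure (Record n 𝒵)}
  {i : Fin n} {g π : 𝒵 → ℝ}

lemma Model.integral_outcomeNoise [IsProbabilityMeasure P] (h : Model P i g π) : ∫ w, outcomeNoise i g w ∂P = 0 := by
  rw [← integral_condExp measurable_covar.comap_le, integral_congr_ae h.condExp_ξ]
  simp

/-- As a conditional expectation of an indicator, π(Z) is almost surely bounded by 1. This makes
every power of the treatment noise integrable. -/
lemma Model.ae_abs_treatNoise_le (h : Model P i g π) : ∀ᵐ w ∂P, |treatNoise i π w| ≤ 2 := by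
  have hd : ∀ w : Record n 𝒵, |treatInd i w| ≤ 1 := fun w => by
    unfold treatInd; split_ifs <;> simp
  filter_upwards [h.propensity, ae_bdd_abs_condExp_of_ae_bdd_abs
    (m := MeasurableSpace.comap covar inferInstance) (ae_of_all P hd)] with w h1 h2
  rw [h1] at h2
  have := abs_sub (treatInd i w) (π (covar w))
  unfold treatNoise
  linarith [hd w]

lemma Model.measurable_treatNoise (h : Model P i g π) : Measurable (treatNoise i π) :=
  (measurable_treatInd i).sub (h.measurable_π.comp measurable_covar)

lemma Model.integrable_weight [IsProbabilityMeasure P] (h : Model P i g π) (e : ℕ → ℝ) (r k : ℕ) :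
    Integrable (weight e r k i π) P := by
  have hpow : ∀ q, Integrable (fun w => treatNoise i π w ^ q) P := fun q => by
    refine Integrable.of_bound (h.measurable_treatNoise.pow_const q).aestronglyMeasurable (2 ^ q) ?_
    filter_upwards [h.ae_abs_treatNoise_le] with w hw
    rw [norm_pow]
    exact pow_le_pow_left₀ (norm_nonneg _) hw q
  exact ((hpow r).const_mul _).add (integrable_finsetSum _ fun q _ =>
    ((hpow q).sub (integrable_const _)).const_mul _)

lemma Model.indepFun_weight (h : Model P i g π) (e : ℕ → ℝ) (r k : ℕ) :
    IndepFun (outcomeNoise i g) (weight e r k i π) P := by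
  have hφ : Measurable fun x : ℝ => coeffTop e r * x ^ r
      + ∑ q ∈ Finset.Icc 1 (k - 1), coeff e r k q * (x ^ q - e q) := by fun_prop
  exact h.indep.comp measurable_id hφ

lemma Model.integrable_score [IsProbabilityMeasure P] (h : Model P i g π) (e : ℕ → ℝ) (r k : ℕ) (θ : ℝ) :
    Integrable (fun w => score e r k i w θ g π) P :=
  ((integrable_const θ).sub h.integrable_g).sub
    ((h.indepFun_weight e r k).integrable_mul h.integrable_ξ (h.integrable_weight e r k))

lemma Model.integral_score [IsProbabilityMeasure P] (h : Model P i g π) (e : ℕ → ℝ) (r k : ℕ) :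
    ∫ w, score e r k i w (∫ w, g (covar w) ∂P) g π ∂P = 0 := by
  have hmul := (h.indepFun_weight e r k).integrable_mul h.integrable_ξ (h.integrable_weight e r k)
  have hg : Integrable (fun w => (∫ w, g (covar w) ∂P) - g (covar w)) P :=
    (integrable_const _).sub h.integrable_g
  simp only [score_true_eq]
  rw [integral_sub hg hmul, integral_sub (integrable_const _) h.integrable_g,
    (h.indepFun_weight e r k).integral_mul_eq_mul_integral h.integrable_ξ.1
      (h.integrable_weight e r k).1, h.integral_outcomeNoise]
  simp

/-- The mean of the score is continuous at the true nuisance functions, in mean square and along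
nuisance values at which the score has bounded second moment. -/
lemma Model.exists_abs_integral_score_le [IsProbabilityMeasure P] (h : Model P i g π) (e : ℕ → ℝ) (r k : ℕ) (M : ℝ≥0)
    {ε : ℝ} (hε : 0 < ε) :
    ∃ δ : ℝ≥0∞, 0 < δ ∧ ∀ f a : 𝒵 → ℝ, Measurable f → Measurable a →
      mse P f g < δ → mse P a π < δ →
      ∫⁻ w, ‖score e r k i w (∫ w, g (covar w) ∂P) f a‖ₑ ^ 2 ∂P ≤ M →
      |∫ w, score e r k i w (∫ w, g (covar w) ∂P) f a ∂P| ≤ ε := by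
  -- Otherwise there are counterexamples for every δ = 2⁻ʲ; summability of these bounds makes the
  -- nuisance functions converge almost surely, and Vitali sends the means to zero.
  by_contra! hcon
  choose f a hf ha hfg haπ hM hbig using fun j : ℕ =>
    hcon ((2⁻¹ : ℝ≥0∞) ^ j) (ENNReal.pow_pos (by simp) j)
  have hgeom : ∑' j : ℕ, (2⁻¹ : ℝ≥0∞) ^ j ≠ ∞ := by
    rw [ENNReal.tsum_geometric]
    simp
  have hlim : ∀ {u : ℕ → 𝒵 → ℝ} {v : 𝒵 → ℝ}, (∀ j, Measurable (u j)) → Measurable v →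
      (∀ j, mse P (u j) v < 2⁻¹ ^ j) →
      ∀ᵐ w ∂P, Tendsto (fun j => u j (covar w)) atTop (𝓝 (v (covar w))) :=
    fun hu hv huv => ae_tendsto_of_tsum_lintegral_sq_ne_top
      (fun j => (hu j).comp measurable_covar) (hv.comp measurable_covar)
      (ne_top_of_le_ne_top hgeom (ENNReal.tsum_le_tsum fun j => (huv j).le))
  have htend := tendsto_integral_of_lintegral_sq_le
    (fun j => (measurable_score_right e r k i _ (hf j) (ha j)).aestronglyMeasurable) hM
    (h.integrable_score e r k (∫ w, g (covar w) ∂P)) (by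
      filter_upwards [hlim hf h.measurable_g hfg, hlim ha h.measurable_π haπ] with w h1 h2
      exact tendsto_score e r k i w _ h1 h2)
  rw [h.integral_score] at htend
  have := htend.abs
  rw [abs_zero] at this
  obtain ⟨j, hj⟩ := (this.eventually_lt_const hε).exists
  exact (hbig j).not_ge hj.le

end Population

end HOEst

namespace HOEst

/-! ### Concentration under sample splitting -/

section Concentration

variable {Ω : Type*} [MeasurableSpace Ω] {μ : Measure Ω} {n : ℕ} {𝒵 : Type*} [MeasurableSpace 𝒵]

lemma Learner.measurable_train {J : Finset ℕ} (L : Learner n 𝒵 J) :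
    Measurable fun p : (J → Record n 𝒵) × 𝒵 => L.toFun (fun j => observe (p.1 j)) p.2 := by
  refine L.measurable_toFun.comp (Measurable.prodMk (measurable_pi_lambda _ fun j => ?_)
    measurable_snd)
  exact measurable_observe.comp ((measurable_pi_apply j).comp measurable_fst)

/-- For fixed nuisance functions at which the score has a small mean and a bounded second moment,
the average score over independent individuals concentrates near zero. -/
lemma measure_le_abs_average_score_le [IsProbabilityMeasure μ] {P : Measure (Record n 𝒵)}
    {V : ℕ → Ω → Record n 𝒵} (hVmeas : ∀ m, Measurable (V m)) (hVlaw : ∀ m, μ.map (V m) = P)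
    (hVindep : iIndepFun V μ) {e : ℕ → ℝ} {r k : ℕ} {i : Fin n} {θ : ℝ} {f a : 𝒵 → ℝ}
    (hf : Measurable f) (ha : Measurable a) {M : ℝ≥0}
    (hM : ∫⁻ w, ‖score e r k i w θ f a‖ₑ ^ 2 ∂P ≤ M) {ε : ℝ} (hε : 0 < ε)
    (hmean : |∫ w, score e r k i w θ f a ∂P| ≤ ε / 2) {I : Finset ℕ} (hI : I.Nonempty) :
    μ {ω | ε ≤ |(1 / (I.card : ℝ)) * ∑ m ∈ I, score e r k i (V m ω) θ f a|}
      ≤ ENNReal.ofReal (4 * M / ε ^ 2 * (1 / (I.card : ℝ))) := by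
  have hs : Measurable fun w : Record n 𝒵 => score e r k i w θ f a :=
    measurable_score_right e r k i θ hf ha
  refine measure_le_abs_average_le (Y := fun m ω => score e r k i (V m ω) θ f a) hI
    (fun m _ => hs.comp (hVmeas m))
    (fun m _ l _ hml => (hVindep.indepFun hml).comp hs hs) (fun m _ => ?_) hε (fun m _ => ?_)
  · rwa [← hVlaw m, lintegral_map (hs.enorm.pow_const 2) (hVmeas m)] at hM
  · rwa [← hVlaw m, integral_map (hVmeas m).aemeasurable hs.aestronglyMeasurable] at hmean

/-- With cross-fitted nuisance functions, the probability that the estimator is off by `ε` while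
the nuisance functions are close to the truth and regular is at most of the order `1 / N`. -/
lemma measure_estimator_error_le [IsProbabilityMeasure μ] {P : Measure (Record n 𝒵)}
    [IsProbabilityMeasure P] {V : ℕ → Ω → Record n 𝒵} (hVmeas : ∀ m, Measurable (V m))
    (hVlaw : ∀ m, μ.map (V m) = P) (hVindep : iIndepFun V μ) {e : ℕ → ℝ} {r k : ℕ} {i : Fin n}
    {g π : 𝒵 → ℝ} (hg : Measurable g) (hπ : Measurable π) {θ : ℝ} {M : ℝ≥0} {ε : ℝ} (hε : 0 < ε)
    {δ : ℝ≥0∞} (hδ : ∀ f a : 𝒵 → ℝ, Measurable f → Measurable a →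
      mse P f g < δ → mse P a π < δ → ∫⁻ w, ‖score e r k i w θ f a‖ₑ ^ 2 ∂P ≤ M →
      |∫ w, score e r k i w θ f a ∂P| ≤ ε / 2)
    {I J : Finset ℕ} (hIJ : Disjoint I J) (hI : I.Nonempty) (Lg Lπ : Learner n 𝒵 J) :
    μ {ω | (mse P (Lg.train fun m => V m ω) g < δ ∧ mse P (Lπ.train fun m => V m ω) π < δ ∧
        ∫⁻ w, ‖score e r k i w θ (Lg.train fun m => V m ω) (Lπ.train fun m => V m ω)‖ₑ ^ 2 ∂P
          ≤ M) ∧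
        ε ≤ |estimator e r k i I (fun m => V m ω) (Lg.train fun m => V m ω)
          (Lπ.train fun m => V m ω) - θ|}
      ≤ ENNReal.ofReal (4 * M / ε ^ 2 * (1 / (I.card : ℝ))) := by
  set F : (J → Record n 𝒵) → 𝒵 → ℝ := fun x => Lg.toFun fun j => observe (x j)
  set A : (J → Record n 𝒵) → 𝒵 → ℝ := fun x => Lπ.toFun fun j => observe (x j)
  have hFm : Measurable fun p : (J → Record n 𝒵) × 𝒵 => F p.1 p.2 := Lg.measurable_train
  have hAm : Measurable fun p : (J → Record n 𝒵) × 𝒵 => A p.1 p.2 := Lπ.measurable_train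
  have hsc := measurable_score e r k i θ hFm hAm
  -- The good event is stated through the second moment bound rather than membership in 𝒯, which
  -- need not be measurable; Fubini requires a measurable set.
  let G : Set (J → Record n 𝒵) := {x | mse P (F x) g < δ ∧ mse P (A x) π < δ ∧
    ∫⁻ w, ‖score e r k i w θ (F x) (A x)‖ₑ ^ 2 ∂P ≤ M}
  have hG : MeasurableSet G :=
    (measurableSet_lt (measurable_mse P hFm hg) measurable_const).inter
      ((measurableSet_lt (measurable_mse P hAm hπ) measurable_const).inter
        (measurableSet_le (hsc.enorm.pow_const 2).lintegral_prod_right' measurable_const))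
  let S : Set ((J → Record n 𝒵) × (I → Record n 𝒵)) := {p | p.1 ∈ G ∧
    ε ≤ |(1 / (I.card : ℝ)) * ∑ m : I, score e r k i (p.2 m) θ (F p.1) (A p.1)|}
  have hS : MeasurableSet S := by
    have hsum : Measurable fun p : (J → Record n 𝒵) × (I → Record n 𝒵) =>
        ∑ m : I, score e r k i (p.2 m) θ (F p.1) (A p.1) :=
      Finset.measurable_fun_sum _ fun m _ =>
        hsc.comp (measurable_fst.prodMk ((measurable_pi_apply m).comp measurable_snd))
    have habs := continuous_abs.measurable.comp (hsum.const_mul (1 / (I.card : ℝ)))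
    exact (measurable_fst hG).inter (habs measurableSet_Ici)
  have hsub : ∀ x ω, (x, fun m : I => V m ω) ∈ S ↔ x ∈ G ∧
      ε ≤ |(1 / (I.card : ℝ)) * ∑ m ∈ I, score e r k i (V m ω) θ (F x) (A x)| := fun x ω => by
    rw [← Finset.sum_coe_sort I]
    rfl
  have key := measure_le_of_indepFun_of_forall_section_le (μ := μ)
    (X := fun ω (j : J) => V j ω) (U := fun ω (m : I) => V m ω)
    (measurable_pi_lambda _ fun j => hVmeas j) (measurable_pi_lambda _ fun m => hVmeas m)
    (hVindep.indepFun_finset J I hIJ.symm hVmeas) hS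
    (c := ENNReal.ofReal (4 * M / ε ^ 2 * (1 / (I.card : ℝ)))) (fun x => by
      simp only [hsub]
      by_cases hx : x ∈ G
      · simp only [hx, true_and]
        have hfx : Measurable (F x) := hFm.comp measurable_prodMk_left
        have hax : Measurable (A x) := hAm.comp measurable_prodMk_left
        exact measure_le_abs_average_score_le hVmeas hVlaw hVindep hfx hax hx.2.2 hε
          (hδ _ _ hfx hax hx.1 hx.2.1 hx.2.2) hI
      · simp [hx])
  refine (measure_mono fun ω hω => ?_).trans key
  refine (hsub _ ω).2 ⟨hω.1, ?_⟩
  rw [average_score_eq e r k i hI, abs_sub_comm]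
  exact hω.2

end Concentration

end HOEst

open HOEst
theorem corollary1 {Ω : Type*} [MeasurableSpace Ω] (μ : Measure Ω) [IsProbabilityMeasure μ]
    {𝒵 : Type*} [MeasurableSpace 𝒵] {n : ℕ}
    -- the population law and the model for treatment `i`
    (P : Measure (Record n 𝒵)) [IsProbabilityMeasure P] (i : Fin n) (g π : 𝒵 → ℝ)
    (hmodel : Model P i g π)
    -- the orders of the score
    (r k : ℕ) (hk : 2 ≤ k) (hkr : k ≤ r) (hr : noiseMoment P i π r ≠ 0)
    -- independent individuals drawn from the population law
    (V : ℕ → Ω → Record n 𝒵) (hVmeas : ∀ m, Measurable (V m)) (hVlaw : ∀ m, μ.map (V m) = P)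
    (hVindep : iIndepFun V μ)
    -- the `t`-th data set is split into `I t` (estimation) and `Ic t` (training)
    (I Ic : ℕ → Finset ℕ) (hdisj : ∀ t, Disjoint (I t) (Ic t))
    (hI : Tendsto (fun t => (I t).card) atTop atTop)
    -- the nuisance functions are trained on the observations in `Ic t`
    (Lg Lπ : ∀ t, Learner n 𝒵 (Ic t)) (ghat pihat : ℕ → Ω → 𝒵 → ℝ)
    (hghat : ∀ t ω, ghat t ω = (Lg t).train fun m => V m ω)
    (hpihat : ∀ t ω, pihat t ω = (Lπ t).train fun m => V m ω)
    -- the causal parameter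
    (θ : ℝ) (hθ : θ = ∫ w, g (covar w) ∂P) :
    -- the empirical moment equation has the stated estimator as its only solution
    (∀ t ω, (I t).Nonempty → ∀ ϑ : ℝ,
      (1 / ((I t).card : ℝ)) * ∑ m ∈ I t,
          score (noiseMoment P i π) r k i (V m ω) ϑ (ghat t ω) (pihat t ω) = 0 ↔
        ϑ = estimator (noiseMoment P i π) r k i (I t) (fun m => V m ω) (ghat t ω) (pihat t ω)) ∧
    -- and under the conditions on the nuisance estimates the estimator is consistent
    (∀ 𝒯 : Set ((𝒵 → ℝ) × (𝒵 → ℝ)),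
      NuisanceConditions μ P r k i g π θ ghat pihat 𝒯 →
      TendstoInMeasure μ
        (fun t ω =>
          estimator (noiseMoment P i π) r k i (I t) (fun m => V m ω) (ghat t ω) (pihat t ω))
        atTop (fun _ => θ)) := by
  refine ⟨fun t ω ht ϑ => by rw [average_score_eq _ r k i ht, sub_eq_zero], fun 𝒯 h𝒯 => ?_⟩
  obtain ⟨M, hM⟩ := h𝒯.regular
  rw [tendstoInMeasure_iff_dist]
  intro ε hε
  -- Half of ε is spent on the bias, the other half on the fluctuation.
  obtain ⟨δ, hδ0, hδ⟩ := hmodel.exists_abs_integral_score_le (noiseMoment P i π) r k M (half_pos hε)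
  rw [← hθ] at hδ
  have hrate : Tendsto (fun t => ENNReal.ofReal (4 * M / ε ^ 2 * (1 / ((I t).card : ℝ)))) atTop
      (𝓝 0) := by
    have h := ((tendsto_one_div_atTop_nhds_zero_nat (𝕜 := ℝ)).comp hI).const_mul (4 * M / ε ^ 2)
    rw [mul_zero] at h
    simpa using ENNReal.tendsto_ofReal h
  have hlim := ((h𝒯.consistent_g δ hδ0).add (h𝒯.consistent_π δ hδ0)).add
    (h𝒯.eventually_mem.add hrate)
  simp only [add_zero] at hlim
  refine tendsto_of_tendsto_of_tendsto_of_le_of_le' tendsto_const_nhds hlim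
    (Eventually.of_forall fun t => zero_le) ?_
  filter_upwards [hI.eventually_ge_atTop 1] with t ht
  have hmain := measure_estimator_error_le hVmeas hVlaw hVindep hmodel.measurable_g
    hmodel.measurable_π hε hδ (hdisj t) (Finset.card_pos.1 ht) (Lg t) (Lπ t)
  simp only [← hghat, ← hpihat] at hmain
  -- Union bound over four events: either nuisance estimate is far off, the pair lies outside 𝒯, or
  -- the error is large on the good event.
  refine (measure_mono fun ω hω => ?_).trans ((measure_union_le _ _).trans
    (add_le_add (measure_union_le _ _) ((measure_union_le _ _).trans (add_le_add le_rfl hmain))))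
  by_cases h1 : δ ≤ mse P (ghat t ω) g
  · exact Or.inl (Or.inl h1)
  by_cases h2 : δ ≤ mse P (pihat t ω) π
  · exact Or.inl (Or.inr h2)
  by_cases h3 : (ghat t ω, pihat t ω) ∈ 𝒯
  · exact Or.inr (Or.inr ⟨⟨not_le.1 h1, not_le.1 h2, hM _ h3⟩, hω⟩)
  · exact Or.inr (Or.inl h3)
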